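/- Let $A$ and $B$ be small strict $2$-categories and let $u : A \to B$ be a strict $2$-functor. Assume that $u$ is a biequivalence, that is: * for all objects $x_0, x_1$ of $A$, the functor $\underline{\mathrm{Hom}}_A(x_0,x_1) \to \underline{\mathrm{Hom}}_B(u(x_0),u(x_1))$ induced by $u$ is an equivalence of categories; and * for every object $y$ of $B$ there are an object $x$ of $A$ and a weakly invertible $1$-cell $f : u(x) \to y$, i.e. one for which there exist a $1$-cell $g : y \to u(x)$ and invertible $2$-cells $gf \Rightarrow 1_{u(x)}$ and $fg \Rightarrow 1_y$. Then $u$ is a Thomason weak equivalence, that is, the morphism of simplicial sets $N_2(u) : N_2(A) \to N_2(B)$ is a weak equivalence in the Kan–Quillen model structure (whose cofibrations are the monomorphisms and whose fibrations are the Kan fibrations). Here $N_2$ is the Street nerve of $2$-categories, $N_2(C)_m = \mathrm{Hom}_{2\text{-}\mathbf{Cat}}(\mathcal{O}_m^{\leq 2}, C)$ for $m \geq 0$, where $\mathcal{O}_m^{\leq 2}$ is the $2$-truncated $m$-th oriental: its objects are $0, 1, \dots, m$; its category of arrows from $k$ to $l$ is the set of subsets $S \subseteq \{0, \dots, m\}$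 with $\min S = k$ and $\max S = l$, ordered by inclusion; the identity of $k$ is $\{k\}$ and composition of $1$-cells is union. An order-preserving map $\varphi : \{0,\dots,p\} \to \{0,\dots,q\}$ induces the $2$-functor $\mathcal{O}_p^{\leq 2} \to \mathcal{O}_q^{\leq 2}$ that sends $k$ to $\varphi(k)$ and $S$ to $\varphi(S)$, and thereby the simplicial structure of $N_2(C)$. -/

import Mathlib

open CategoryTheory Bicategory Opposite Simplicial

universe u

/-! Throughout, a small (strict) 2-category is a type `A : Type u` with instances
`[Bicategory.{u, u} A] [Bicategory.Strict A]`, and a (strict) 2-functor is a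
`StrictPseudofunctor A B`.  Mathlib writes composition in diagrammatic order: `f ≫ g` is
`g ∘ f`. -/

section

universe w₁ w₂ w₃ w₄ v₁ v₂ v₃ v₄ u₁ u₂ u₃ u₄

variable {A : Type u₁} {B : Type u₂} {C : Type u₃} {D : Type u₄}
  [Bicategory.{w₁, v₁} A] [Bicategory.{w₂, v₂} B] [Bicategory.{w₃, v₃} C]
  [Bicategory.{w₄, v₄} D]

/-- A 2-functor is determined by its action on objects, 1-cells and 2-cells. -/
theorem strictPseudofunctor_ext {F G : StrictPseudofunctor A B}
    (h : F.toPrelaxFunctor = G.toPrelaxFunctor) : F = G := by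
  obtain ⟨⟨⟨F, i, c, _, _, _, _, _⟩, i', hi⟩, c', hc⟩ := F
  obtain ⟨⟨⟨G, j, d, _, _, _, _, _⟩, j', hj⟩, d', hd⟩ := G
  dsimp at h
  subst h
  obtain rfl : i = j := by
    funext x
    exact (hi x).trans (hj x).symm
  obtain rfl : @c = @d := by
    funext x y z f g
    exact (hc f g).trans (hd f g).symm
  rfl

theorem strictPseudofunctor_id_comp (F : StrictPseudofunctor A B) :
    (StrictPseudofunctor.id A).comp F = F :=
  strictPseudofunctor_ext rfl

theorem strictPseudofunctor_comp_assoc (F : StrictPseudofunctor A B)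
    (G : StrictPseudofunctor B C) (H : StrictPseudofunctor C D) :
    (F.comp G).comp H = F.comp (G.comp H) :=
  strictPseudofunctor_ext rfl

end

/-! ### The 2-truncated orientals -/

/-- The type of objects of the 2-category `𝒪(E)` attached to a totally ordered set `E`.
For `E = {0 < 1 < ⋯ < m}` this is the 2-truncation of Street's `m`-th oriental. -/
structure Oriental (E : Type u) : Type u where
  pt : E

namespace Oriental

variable {E E' : Type u} [LinearOrder E] [LinearOrder E']

/-- A 1-cell `x ⟶ y` of `𝒪(E)`: a finite subset `S ⊆ E` with `min S = x` and `max S = y`. -/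
@[ext]
structure Path (x y : Oriental E) : Type u where
  carrier : Finset E
  isLeast : IsLeast (carrier : Set E) x.pt
  isGreatest : IsGreatest (carrier : Set E) y.pt

/-- Parallel 1-cells are ordered by inclusion. -/
instance (x y : Oriental E) : PartialOrder (Path x y) :=
  PartialOrder.lift Path.carrier fun _ _ h => Path.ext h

/-- The identity of `x` is `{x}`, and the composite of two composable 1-cells is their union. -/
instance : CategoryStruct.{u} (Oriental E) where
  Hom x y := Path x y
  id x := ⟨{x.pt}, by simp, by simp⟩
  comp {x y z} S T :=
    ⟨S.carrier ∪ T.carrier,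
      by
        have h : x.pt ≤ y.pt := S.isLeast.2 S.isGreatest.1
        have := S.isLeast.union T.isLeast
        rwa [min_eq_left h, ← Finset.coe_union] at this,
      by
        have h : y.pt ≤ z.pt := T.isLeast.2 T.isGreatest.1
        have := S.isGreatest.union T.isGreatest
        rwa [max_eq_right h, ← Finset.coe_union] at this⟩

/-- There is exactly one 2-cell `S ⟶ T` if `S ⊆ T`, and none otherwise. -/
instance (x y : Oriental E) : Category.{u} (x ⟶ y) :=
  inferInstanceAs (Category.{u} (Path x y))

instance (x y : Oriental E) : Quiver.IsThin (x ⟶ y) :=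
  inferInstanceAs (Quiver.IsThin (Path x y))

theorem hom_ext {x y : Oriental E} {S T : x ⟶ y} (h : S.carrier = T.carrier) : S = T :=
  Path.ext h

/-- The 2-cell given by an inclusion. -/
def homOfSubset {x y : Oriental E} {S T : x ⟶ y} (h : S.carrier ⊆ T.carrier) : S ⟶ T :=
  homOfLE (X := Path x y) h

theorem subset_of_hom {x y : Oriental E} {S T : x ⟶ y} (η : S ⟶ T) : S.carrier ⊆ T.carrier :=
  leOfHom (X := Path x y) η

@[simp] theorem id_carrier (x : Oriental E) : Path.carrier (𝟙 x) = {x.pt} := rfl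

@[simp] theorem comp_carrier {x y z : Oriental E} (S : x ⟶ y) (T : y ⟶ z) :
    Path.carrier (S ≫ T) = S.carrier ∪ T.carrier := rfl

theorem id_comp' {x y : Oriental E} (S : x ⟶ y) : 𝟙 x ≫ S = S :=
  hom_ext (by simpa using S.isLeast.1)

theorem comp_id' {x y : Oriental E} (S : x ⟶ y) : S ≫ 𝟙 y = S :=
  hom_ext (by simpa using S.isGreatest.1)

theorem assoc' {x y z t : Oriental E} (S : x ⟶ y) (T : y ⟶ z) (U : z ⟶ t) :
    (S ≫ T) ≫ U = S ≫ T ≫ U :=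
  hom_ext (by simp [Finset.union_assoc])

/-- The 2-category `𝒪(E)`. -/
instance : Bicategory.{u, u} (Oriental E) where
  homCategory _ _ := inferInstance
  whiskerLeft _ _ _ η := homOfSubset (Finset.union_subset_union_right (subset_of_hom η))
  whiskerRight η _ := homOfSubset (Finset.union_subset_union_left (subset_of_hom η))
  associator S T U := eqToIso (assoc' S T U)
  leftUnitor S := eqToIso (id_comp' S)
  rightUnitor S := eqToIso (comp_id' S)
  whiskerLeft_id _ _ := Subsingleton.elim _ _
  whiskerLeft_comp _ _ _ _ _ _ := Subsingleton.elim _ _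
  id_whiskerLeft _ := Subsingleton.elim _ _
  comp_whiskerLeft _ _ _ _ _ := Subsingleton.elim _ _
  id_whiskerRight _ _ := Subsingleton.elim _ _
  comp_whiskerRight _ _ _ := Subsingleton.elim _ _
  whiskerRight_id _ := Subsingleton.elim _ _
  whiskerRight_comp _ _ _ := Subsingleton.elim _ _
  whisker_assoc _ _ _ _ _ := Subsingleton.elim _ _
  whisker_exchange _ _ := Subsingleton.elim _ _
  pentagon _ _ _ _ := Subsingleton.elim _ _
  triangle _ _ := Subsingleton.elim _ _

instance : Bicategory.Strict (Oriental E) where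
  id_comp := id_comp'
  comp_id := comp_id'
  assoc := assoc'
  leftUnitor_eqToIso _ := rfl
  rightUnitor_eqToIso _ := rfl
  associator_eqToIso _ _ _ := rfl

/-- The 2-functor `𝒪(φ) : 𝒪(E) ⟶ 𝒪(E')` induced by an order-preserving map `φ`: it sends an
object `x` to `φ x` and a 1-cell `S` to its image `φ(S)`. -/
def map (φ : E →o E') : StrictPseudofunctor (Oriental E) (Oriental E') :=
  StrictPseudofunctor.mk''
    { obj := fun x => ⟨φ x.pt⟩
      map := fun S =>
        ⟨S.carrier.image φ,
          by simpa using φ.monotone.map_isLeast S.isLeast,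
          by simpa using φ.monotone.map_isGreatest S.isGreatest⟩
      map₂ := fun η => homOfSubset (Finset.image_subset_image (subset_of_hom η))
      map₂_id := fun _ => Subsingleton.elim _ _
      map₂_comp := fun _ _ => Subsingleton.elim _ _
      map_id := fun _ => hom_ext (by simp)
      map_comp := fun _ _ => hom_ext (by simp [Finset.image_union])
      map₂_whisker_left := fun _ _ _ _ => Subsingleton.elim _ _
      map₂_whisker_right := fun _ _ => Subsingleton.elim _ _ }

theorem strictPseudofunctor_ext {A : Type u} [Bicategory.{u, u} A]
    {F G : StrictPseudofunctor A (Oriental E)} (hobj : ∀ x, F.obj x = G.obj x)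
    (hmap : ∀ {x y : A} (f : x ⟶ y), (F.map f).carrier = (G.map f).carrier) : F = G := by
  apply _root_.strictPseudofunctor_ext
  obtain ⟨⟨⟨⟨⟨⟨Fo, Fm⟩, F2⟩, _, _⟩, _, _, _, _, _, _, _⟩, _, _⟩, _, _⟩ := F
  obtain ⟨⟨⟨⟨⟨⟨Go, Gm⟩, G2⟩, _, _⟩, _, _, _, _, _, _, _⟩, _, _⟩, _, _⟩ := G
  obtain rfl : Fo = Go := funext hobj
  obtain rfl : @Fm = @Gm := by
    funext x y f
    exact hom_ext (hmap f)
  obtain rfl : @F2 = @G2 := by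
    funext x y f g η
    exact Subsingleton.elim _ _
  rfl

theorem map_id : map (OrderHom.id (α := E)) = StrictPseudofunctor.id (Oriental E) :=
  strictPseudofunctor_ext (fun _ => rfl) fun _ => Finset.image_id

theorem map_comp {E'' : Type u} [LinearOrder E''] (φ : E →o E') (ψ : E' →o E'') :
    map (ψ.comp φ) = (map φ).comp (map ψ) :=
  strictPseudofunctor_ext (fun _ => rfl) fun f =>
    (Finset.image_image (s := f.carrier) (f := φ) (g := ψ)).symm

end Oriental

/-! ### The nerve of a 2-category -/

/-- The nerve `N₂(A)` of a small 2-category `A` (Street nerve): its `m`-simplices are the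
2-functors `𝒪({0 < ⋯ < m}) ⟶ A`. -/
def streetNerve (A : Type u) [Bicategory.{u, u} A] [Bicategory.Strict A] : SSet.{u} where
  obj m := StrictPseudofunctor (Oriental (Fin (m.unop.len + 1))) A
  map φ := ↾fun F => (Oriental.map φ.unop.toOrderHom).comp F
  map_id m := by
    ext F
    exact (congrArg (StrictPseudofunctor.comp · F) Oriental.map_id).trans
      (strictPseudofunctor_id_comp F)
  map_comp φ ψ := by
    ext F
    exact (congrArg (StrictPseudofunctor.comp · F)
      (Oriental.map_comp ψ.unop.toOrderHom φ.unop.toOrderHom)).trans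
      (strictPseudofunctor_comp_assoc _ _ F)

/-- The morphism of simplicial sets `N₂(F)` induced by a 2-functor `F`, by postcomposition. -/
def streetNerveMap {A B : Type u} [Bicategory.{u, u} A] [Bicategory.Strict A]
    [Bicategory.{u, u} B] [Bicategory.Strict B] (F : StrictPseudofunctor A B) :
    streetNerve A ⟶ streetNerve B where
  app m := ↾fun G => G.comp F
  naturality _ _ _ := by
    ext G
    exact strictPseudofunctor_comp_assoc _ G F

/-! ### Weak equivalences -/

/-- The weak equivalences of the Kan–Quillen model structure on simplicial sets, whose
cofibrations are the monomorphisms and whose fibrations are the Kan fibrations.  As in any model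
category, these are the composites `i ≫ p` of a trivial cofibration `i` (a morphism with the left
lifting property against all fibrations) and a trivial fibration `p` (a morphism with the right
lifting property against all cofibrations). -/
def SSet.IsWeakEquivalence {X Y : SSet.{u}} (f : X ⟶ Y) : Prop :=
  ∃ (Z : SSet.{u}) (i : X ⟶ Z) (p : Z ⟶ Y),
    SSet.modelCategoryQuillen.J.{u}.rlp.llp i ∧
      (MorphismProperty.monomorphisms SSet.{u}).rlp p ∧ i ≫ p = f

section

variable {A B : Type u} [Bicategory.{u, u} A] [Bicategory.Strict A]
  [Bicategory.{u, u} B] [Bicategory.Strict B]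

/-- A 2-functor is a Thomason weak equivalence if its nerve is a weak equivalence of simplicial
sets. -/
def IsThomasonWeakEquivalence (F : StrictPseudofunctor A B) : Prop :=
  SSet.IsWeakEquivalence (streetNerveMap F)

/-- A 1-cell `f : x ⟶ y` is weakly invertible if there are a 1-cell `g : y ⟶ x` and invertible
2-cells `g ∘ f ⇒ 1_x` and `f ∘ g ⇒ 1_y`. -/
def IsWeaklyInvertible {x y : A} (f : x ⟶ y) : Prop :=
  ∃ g : y ⟶ x, Nonempty (f ≫ g ≅ 𝟙 x) ∧ Nonempty (g ≫ f ≅ 𝟙 y)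

/-- A 2-functor `F : A ⟶ B` is a biequivalence if it induces equivalences of categories
`A(x, x') ⟶ B(F x, F x')` and if every object `y` of `B` admits a weakly invertible 1-cell
`F x ⟶ y` for some object `x` of `A`. -/
def IsBiequivalence (F : StrictPseudofunctor A B) : Prop :=
  (∀ x x' : A, (F.mapFunctor x x').IsEquivalence) ∧
    ∀ y : B, ∃ (x : A) (f : F.obj x ⟶ y), IsWeaklyInvertible f

end

-- The 2-functor `F` factors through its iso-comma 2-category, whose objects are weakly invertible
-- 1-cells `F x ⟶ y`, whose 1-cells are squares filled by an invertible 2-cell, and whose 2-cells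
-- are compatible pairs of 2-cells. Sending `x` to the identity of `F x` gives `diagonal F`, a
-- section of the projection to `A`, and the projection to `B` composed with it is `F`.
--
-- Both projections are surjective on objects, full on 1-cells and fully faithful on 2-cells; for
-- the projection to `B` this is where the biequivalence is used. The nerve of such a 2-functor is a
-- trivial Kan fibration (`rlp_streetNerveMap`): the 1-cells of an oriental are freely generated by
-- its edges, so a simplex lifts as soon as its vertices and edges do, and the lifts of 2-cells are
-- unique.
--
-- Finally, a section of a trivial fibration is a strong deformation retract, hence anodyne
-- (`anodyneExtensions_of_section`). The nerve of `F` is thus an anodyne extension followed by a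
-- trivial fibration.

universe w v₁ v₂ w₁ w₂ u₁ u₂

/-! ### Sections of trivial Kan fibrations -/

namespace SSet

open MonoidalCategory CartesianMonoidalCategory

variable {X Y : SSet.{u}}

/-- An endomorphism `e` of `Y` that is the identity on a subcomplex `A` defines, together with the
identity of `Y`, a morphism `Y × ∂Δ[1] ∪ A × Δ[1] ⟶ Y`. -/
noncomputable def unionProdBoundaryDesc (A : Y.Subcomplex) (e : Y ⟶ Y)
    (he : ∀ m, ∀ y ∈ A.obj m, e.app m y = y) :
    (A.unionProd ∂Δ[1] : SSet.{u}) ⟶ Y where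
  app m := ↾fun z => open scoped Classical in
    if ∀ k, stdSimplex.asOrderHom z.1.2 k = 1 then z.1.1 else e.app m z.1.1
  naturality m m' φ := by
    ext ⟨⟨y, θ⟩, hz⟩
    have key : ∀ k, stdSimplex.asOrderHom (Δ[1].map φ θ) k =
      stdSimplex.asOrderHom θ (φ.unop.toOrderHom k) := fun k => rfl
    change (if ∀ k, stdSimplex.asOrderHom (Δ[1].map φ θ) k = 1 then Y.map φ y else
        e.app m' (Y.map φ y)) =
      Y.map φ (if ∀ k, stdSimplex.asOrderHom θ k = 1 then y else e.app m y)
    have nat : e.app m' (Y.map φ y) = Y.map φ (e.app m y) :=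
      ConcreteCategory.congr_hom (e.naturality φ) y
    rw [nat]
    -- A simplex of `∂Δ[1]` is constant, so restricting it cannot change the branch of the `if`;
    -- over `A` the two branches agree.
    rcases (Subcomplex.mem_unionProd_iff _ _ _).1 hz with h | h
    · by_cases h1 : ∀ k, stdSimplex.asOrderHom θ k = 1
      · rw [if_pos h1, if_pos (fun k => (key k).trans (h1 _))]
      · rw [if_neg h1, if_neg]
        intro h2
        refine h fun j => ?_
        push Not at h1
        obtain ⟨k, hk⟩ := h1
        have h3 := h2 0
        rw [key] at h3
        fin_cases j
        · exact ⟨k, (show ∀ a : Fin 2, a ≠ 1 → a = 0 by decide) _ hk⟩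
        · exact ⟨_, h3⟩
    · have hy : e.app m y = y := he m y h
      rw [hy, ite_self, ite_self]

/-- A section of a trivial fibration is an anodyne extension. -/
theorem anodyneExtensions_of_section (i : X ⟶ Y) (r : Y ⟶ X) (hir : i ≫ r = 𝟙 X)
    (hr : (MorphismProperty.monomorphisms SSet.{u}).rlp r) : anodyneExtensions i := by
  have hri : ∀ m (x : X.obj m), r.app m (i.app m x) = x := fun m x =>
    ConcreteCategory.congr_hom (congr_app hir m) x
  let A := Subcomplex.range i
  have he : ∀ m, ∀ y ∈ A.obj m, (r ≫ i).app m y = y := by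
    rintro m _ ⟨x, rfl⟩
    change i.app m (r.app m (i.app m x)) = _
    rw [hri]
  -- `H` is a homotopy over `X`, constant on the image of `i`, from `r ≫ i` at the end 0 to the
  -- identity at the end 1. It exists because `r` lifts against monomorphisms.
  obtain ⟨H, hH⟩ : ∃ H : Y ⊗ Δ[1] ⟶ Y,
      (A.unionProd ∂Δ[1]).ι ≫ H = unionProdBoundaryDesc A (r ≫ i) he := by
    have : HasLiftingProperty (A.unionProd ∂Δ[1]).ι r := hr _ (.infer_property _)
    have sq : CommSq (unionProdBoundaryDesc A (r ≫ i) he) (A.unionProd ∂Δ[1]).ι r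
        (fst _ _ ≫ r) := ⟨by
      ext m ⟨⟨y, θ⟩, hz⟩
      change r.app m (if ∀ k, stdSimplex.asOrderHom θ k = 1 then y else i.app m (r.app m y)) =
        r.app m y
      split_ifs
      · rfl
      · rw [hri]⟩
    exact ⟨sq.lift, sq.fac_left⟩
  have hH' : ∀ m (y : Y.obj m) (θ : (Δ[1] : SSet.{u}).obj m)
      (hz : (y, θ) ∈ (A.unionProd ∂Δ[1]).obj m),
      H.app m (y, θ) =
        open scoped Classical in
        if ∀ k, stdSimplex.asOrderHom θ k = 1 then y else i.app m (r.app m y) :=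
    fun m y θ hz => ConcreteCategory.congr_hom (congr_app hH m) ⟨(y, θ), hz⟩
  intro E B p hp
  constructor
  intro t b sq
  -- `Λ[1, 0]` is the end 0. The homotopy `H ≫ b` is lifted along `p`, starting from `r ≫ t` and
  -- constant on `A`; the end 1 of the lift is the required diagonal.
  have hAp : HasLiftingProperty (A.unionProd Λ[1, 0]).ι p :=
    anodyneExtensions_unionProd_ι A Λ[1, 0] (.horn_ι 0) _ hp
  have sqc : ∀ m x, p.app m (t.app m x) = b.app m (i.app m x) := fun m x =>
    ConcreteCategory.congr_hom (congr_app sq.w m) x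
  have sq' : CommSq ((A.unionProd Λ[1, 0]).ι ≫ fst _ _ ≫ r ≫ t) (A.unionProd Λ[1, 0]).ι p
      (H ≫ b) := ⟨by
    ext m ⟨⟨y, θ⟩, hz⟩
    change p.app m (t.app m (r.app m y)) = b.app m (H.app m (y, θ))
    rw [sqc]
    congr 1
    rcases (Subcomplex.mem_unionProd_iff _ _ _).1 hz with h | h
    · have h0 : ∀ k, stdSimplex.asOrderHom θ k ≠ 1 := by
        intro k hk
        refine h (Set.eq_univ_of_forall fun j => ?_)
        fin_cases j
        · exact Or.inr rfl
        · exact Or.inl ⟨k, hk⟩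
      rw [hH', if_neg fun h1 => h0 0 (h1 0)]
      refine (Subcomplex.mem_unionProd_iff _ _ _).2 (Or.inl fun hs => ?_)
      obtain ⟨k, hk⟩ := hs 1
      exact h0 k hk
    · rw [hH' m y θ ((Subcomplex.mem_unionProd_iff _ _ _).2 (Or.inr h)),
        show i.app m (r.app m y) = y from he m y h, ite_self]⟩
  have hL : ∀ m (y : Y.obj m) (θ : (Δ[1] : SSet.{u}).obj m)
      (hz : (y, θ) ∈ (A.unionProd Λ[1, 0]).obj m),
      sq'.lift.app m (y, θ) = t.app m (r.app m y) :=
    fun m y θ hz => ConcreteCategory.congr_hom (congr_app sq'.fac_left m) ⟨(y, θ), hz⟩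
  have hLp : ∀ m z, p.app m (sq'.lift.app m z) = b.app m (H.app m z) := fun m z =>
    ConcreteCategory.congr_hom (congr_app sq'.fac_right m) z
  refine ⟨⟨ι₁ ≫ sq'.lift, ?_, ?_⟩⟩
  · ext m x
    refine (hL m _ _ ((Subcomplex.mem_unionProd_iff _ _ _).2 (Or.inr ⟨x, rfl⟩))).trans ?_
    exact congrArg (t.app m) (hri m x)
  · ext m y
    refine (hLp m _).trans (congrArg (b.app m) ?_)
    refine (hH' m y _ ((Subcomplex.mem_unionProd_iff _ _ _).2 (Or.inl ?_))).trans (if_pos ?_)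
    · intro hs
      obtain ⟨k, hk⟩ := hs 0
      exact one_ne_zero hk
    · exact fun k => rfl

end SSet

/-! ### Free generation of the 1-cells of an oriental by its edges -/

namespace Oriental

section

variable {E : Type w} [LinearOrder E]

/-- The 1-cell `{x, y}` of `𝒪(E)`. -/
def edge (x y : Oriental E) (h : x.pt ≤ y.pt) : x ⟶ y :=
  ⟨{x.pt, y.pt}, by simp [IsLeast, lowerBounds, h], by simp [IsGreatest, upperBounds, h]⟩

@[simp] theorem edge_carrier (x y : Oriental E) (h : x.pt ≤ y.pt) :
    (edge x y h).carrier = {x.pt, y.pt} := rfl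

theorem pt_le_of_hom {x y : Oriental E} (S : x ⟶ y) : x.pt ≤ y.pt :=
  S.isLeast.2 S.isGreatest.1

theorem pt_lt_of_ne {x y : Oriental E} (S : x ⟶ y) (h : x ≠ y) : x.pt < y.pt :=
  lt_of_le_of_ne (pt_le_of_hom S) fun h' => h (congrArg Oriental.mk h')

theorem erase_nonempty {x y : Oriental E} (S : x ⟶ y) (h : x ≠ y) :
    (S.carrier.erase x.pt).Nonempty :=
  ⟨y.pt, Finset.mem_erase.2 ⟨(pt_lt_of_ne S h).ne', S.isGreatest.1⟩⟩

/-- The second smallest element of a 1-cell that is not an identity. -/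
def second {x y : Oriental E} (S : x ⟶ y) (h : x ≠ y) : Oriental E :=
  ⟨(S.carrier.erase x.pt).min' (erase_nonempty S h)⟩

/-- A 1-cell that is not an identity, without its least element. -/
def tail {x y : Oriental E} (S : x ⟶ y) (h : x ≠ y) : second S h ⟶ y :=
  ⟨S.carrier.erase x.pt, Finset.isLeast_min' _ (erase_nonempty S h),
    Finset.mem_coe.2 (Finset.mem_erase.2 ⟨(pt_lt_of_ne S h).ne', S.isGreatest.1⟩),
    fun _ hz => S.isGreatest.2 (Finset.mem_of_mem_erase hz)⟩

theorem lt_second {x y : Oriental E} (S : x ⟶ y) (h : x ≠ y) : x.pt < (second S h).pt := by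
  have := Finset.mem_erase.1 (Finset.min'_mem _ (erase_nonempty S h))
  exact lt_of_le_of_ne (S.isLeast.2 this.2) this.1.symm

theorem card_tail_lt {x y : Oriental E} (S : x ⟶ y) (h : x ≠ y) :
    (tail S h).carrier.card < S.carrier.card :=
  Finset.card_erase_lt_of_mem S.isLeast.1

theorem edge_comp_tail {x y : Oriental E} (S : x ⟶ y) (h : x ≠ y) :
    edge x (second S h) (lt_second S h).le ≫ tail S h = S := by
  refine hom_ext ?_
  have h1 : (second S h).pt ∈ S.carrier.erase x.pt := (tail S h).isLeast.1
  have h2 : x.pt ∈ S.carrier := S.isLeast.1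
  rw [comp_carrier, edge_carrier]
  ext a
  simp only [tail, Finset.mem_union, Finset.mem_insert, Finset.mem_singleton, Finset.mem_erase]
  constructor
  · rintro ((rfl | rfl) | h3)
    exacts [h2, Finset.mem_of_mem_erase h1, h3.2]
  · intro h3
    by_cases h4 : a = x.pt
    exacts [Or.inl (Or.inl h4), Or.inr ⟨h4, h3⟩]

theorem eq_id {x : Oriental E} (S : x ⟶ x) : S = 𝟙 x := by
  refine hom_ext (Finset.eq_singleton_iff_unique_mem.2 ⟨S.isLeast.1, fun a ha => ?_⟩)
  exact le_antisymm (S.isGreatest.2 ha) (S.isLeast.2 ha)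

/-- The 1-cells of `𝒪(E)` are generated by the edges. -/
theorem hom_induction {motive : ∀ x y : Oriental E, (x ⟶ y) → Prop}
    (id : ∀ x, motive x x (𝟙 x))
    (cons : ∀ (x y z : Oriental E) (h : x.pt < y.pt) (S : y ⟶ z), motive y z S →
      motive x z (edge x y h.le ≫ S)) {x y : Oriental E} (S : x ⟶ y) : motive x y S := by
  induction hn : S.carrier.card using Nat.strong_induction_on generalizing x with
  | _ n ih =>
    by_cases h : x = y
    · subst h
      rw [eq_id S]
      exact id x
    · rw [← edge_comp_tail S h]
      exact cons _ _ _ (lt_second S h) _ (ih _ (hn ▸ card_tail_lt S h) _ rfl)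

section

variable {C : Type u₁} [Category.{v₁} C] (X : Oriental E → C)
  (e : ∀ i j : Oriental E, i.pt < j.pt → (X i ⟶ X j))

/-- The composite of the images of the consecutive edges of a 1-cell of `𝒪(E)`. -/
noncomputable def descMap {x y : Oriental E} (S : x ⟶ y) : X x ⟶ X y :=
  open scoped Classical in
  if h : x = y then eqToHom (congrArg X h)
  else e x (second S h) (lt_second S h) ≫ descMap (tail S h)
termination_by S.carrier.card
decreasing_by exact card_tail_lt S h

theorem descMap_id (x : Oriental E) : descMap X e (𝟙 x) = 𝟙 (X x) := by
  rw [descMap, dif_pos rfl, eqToHom_refl]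

theorem descMap_edge_comp {x y z : Oriental E} (h : x.pt < y.pt) (S : y ⟶ z) :
    descMap X e (edge x y h.le ≫ S) = e x y h ≫ descMap X e S := by
  have hx : x.pt ∉ S.carrier := fun hx => h.not_ge (S.isLeast.2 hx)
  have hne : x ≠ z := fun hxz => (h.trans_le (pt_le_of_hom S)).ne (congrArg Oriental.pt hxz)
  have hc : (edge x y h.le ≫ S).carrier.erase x.pt = S.carrier := by
    have hy : y.pt ∈ S.carrier := S.isLeast.1
    rw [comp_carrier, edge_carrier]
    ext a
    simp only [Finset.mem_erase, Finset.mem_union, Finset.mem_insert, Finset.mem_singleton]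
    constructor
    · rintro ⟨h1, (h2 | rfl) | h2⟩
      exacts [(h1 h2).elim, hy, h2]
    · exact fun h1 => ⟨fun h2 => hx (h2 ▸ h1), Or.inr h1⟩
  -- The second element and the tail of the composite equal `y` and `S` only propositionally, so the
  -- comparison is made for any 1-cell with the same underlying set.
  have key : ∀ (y' : Oriental E) (h' : x.pt < y'.pt) (S' : y' ⟶ z), S'.carrier = S.carrier →
      e x y' h' ≫ descMap X e S' = e x y h ≫ descMap X e S := by
    rintro ⟨y'⟩ h' S' hS
    obtain ⟨y⟩ := y
    obtain rfl : y' = y := S'.isLeast.unique (hS ▸ S.isLeast)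
    rw [hom_ext hS]
  rw [descMap, dif_neg hne]
  exact key _ _ _ hc

theorem descMap_edge {x y : Oriental E} (h : x.pt < y.pt) :
    descMap X e (edge x y h.le) = e x y h := by
  have := descMap_edge_comp X e h (𝟙 y)
  rwa [comp_id', descMap_id, Category.comp_id] at this

theorem descMap_comp {x y z : Oriental E} (S : x ⟶ y) (T : y ⟶ z) :
    descMap X e (S ≫ T) = descMap X e S ≫ descMap X e T := by
  induction S using hom_induction with
  | id x => rw [id_comp', descMap_id, Category.id_comp]
  | cons x y z h S ih =>
    rw [assoc', descMap_edge_comp X e h, descMap_edge_comp X e h, ih, Category.assoc]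

end

end

end Oriental

/-! ### Trivial fibrations of 2-categories and lifts of 2-functors out of orientals -/

section

variable {P : Type u₁} {Q : Type u₂} [Bicategory.{w₁, v₁} P] [Bicategory.{w₂, v₂} Q]

/-- A 2-functor is a trivial fibration if it is surjective on objects, full on 1-cells and fully
faithful on 2-cells. -/
structure IsTrivialTwoFibration (p : StrictPseudofunctor P Q) : Prop where
  obj_surjective : Function.Surjective p.obj
  map_surjective : ∀ x y : P, Function.Surjective (fun f : x ⟶ y => p.map f)
  map₂_bijective : ∀ {x y : P} (f g : x ⟶ y), Function.Bijective (fun η : f ⟶ g => p.map₂ η)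

/-- Equal 2-functors have values whose endpoints agree only propositionally, hence `HEq`. -/
theorem StrictPseudofunctor.map_heq {F G : StrictPseudofunctor P Q} (h : F = G) {x y : P}
    (f : x ⟶ y) : HEq (F.map f) (G.map f) := by
  subst h; rfl

theorem StrictPseudofunctor.map₂_heq {F G : StrictPseudofunctor P Q} (h : F = G) {x y : P}
    {f g : x ⟶ y} (η : f ⟶ g) : HEq (F.map₂ η) (G.map₂ η) := by
  subst h; rfl

end

namespace IsTrivialTwoFibration

open Oriental

variable {P : Type u₁} {Q : Type u₂} [Bicategory.{w₁, v₁} P] [Bicategory.{w₂, v₂} Q]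
  {p : StrictPseudofunctor P Q} {E : Type w} [LinearOrder E]

/-- A 2-functor out of `𝒪(E)` lifts along a trivial fibration, with prescribed lifts of the objects
and of the edges. -/
theorem exists_lift [Bicategory.Strict P] (hp : IsTrivialTwoFibration p)
    (σ : StrictPseudofunctor (Oriental E) Q) (X : Oriental E → P)
    (hX : ∀ i, p.obj (X i) = σ.obj i) (e : ∀ i j : Oriental E, i.pt < j.pt → (X i ⟶ X j))
    (he : ∀ i j h, HEq (p.map (e i j h)) (σ.map (edge i j h.le))) :
    ∃ τ : StrictPseudofunctor (Oriental E) P, τ.comp p = σ ∧ (∀ i, τ.obj i = X i) ∧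
      ∀ i j h, HEq (τ.map (edge i j h.le)) (e i j h) := by
  have hid := σ.map_id
  have hcomp := @σ.map_comp
  have hwl : ∀ {a b c : Oriental E} (f : a ⟶ b) {g g' : b ⟶ c} (η : g ⟶ g'),
      σ.map₂ (f ◁ η) = eqToHom (σ.map_comp f g) ≫
        σ.map f ◁ σ.map₂ η ≫ eqToHom (σ.map_comp f g').symm := fun f _ _ η => by
    rw [σ.map₂_whisker_left, σ.mapComp_eq_eqToIso, σ.mapComp_eq_eqToIso]; rfl
  have hwr : ∀ {a b c : Oriental E} {f f' : a ⟶ b} (η : f ⟶ f') (g : b ⟶ c),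
      σ.map₂ (η ▷ g) = eqToHom (σ.map_comp f g) ≫
        σ.map₂ η ▷ σ.map g ≫ eqToHom (σ.map_comp f' g).symm := fun η g => by
    rw [σ.map₂_whisker_right, σ.mapComp_eq_eqToIso, σ.mapComp_eq_eqToIso]; rfl
  suffices H : ∃ τ : StrictPseudofunctor (Oriental E) P,
      (τ.comp p).toPrelaxFunctor = σ.toPrelaxFunctor ∧ (∀ i, τ.obj i = X i) ∧
      ∀ i j h, HEq (τ.map (edge i j h.le)) (e i j h) by
    obtain ⟨τ, h1, h2⟩ := H
    exact ⟨τ, _root_.strictPseudofunctor_ext h1, h2⟩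
  -- With `σ` unpacked, its actions on objects and 1-cells can be replaced by the images under `p`
  -- of `X` and `descMap X e`, after which no transport is left in the problem of lifting 2-cells.
  obtain ⟨⟨⟨⟨⟨⟨So, Sm⟩, S2⟩, S2id, S2comp⟩, _, _, _, _, _, _, _⟩, _, _⟩, _, _⟩ := σ
  dsimp at hX he hid hcomp hwl hwr S2id S2comp ⊢
  obtain rfl : (fun i => p.obj (X i)) = So := funext hX
  have hm : ∀ {x y : Oriental E} (S : x ⟶ y), p.map (descMap X e S) = Sm S := by
    intro x y S
    induction S using hom_induction with
    | id x => rw [descMap_id, hid]; exact p.map_id _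
    | cons x y z h S ih =>
      rw [descMap_edge_comp, hcomp, ← ih, ← eq_of_heq (he x y h)]
      exact p.map_comp _ _
  obtain rfl : @(fun x y S => p.map (descMap X e S)) = @Sm := by
    funext x y S
    exact hm S
  -- Fullness on 2-cells gives the lifts; their functoriality and whiskering laws hold after
  -- applying `p`, hence hold by faithfulness.
  obtain ⟨L, hL⟩ : ∃ L : ∀ {x y : Oriental E} {S T : x ⟶ y}, (S ⟶ T) →
      (descMap X e S ⟶ descMap X e T), ∀ {x y : Oriental E} {S T : x ⟶ y} (η : S ⟶ T),
        p.map₂ (L η) = S2 η :=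
    ⟨fun η => Function.surjInv (hp.map₂_bijective _ _).2 (S2 η),
      fun η => Function.surjInv_eq _ _⟩
  refine ⟨StrictPseudofunctor.mk''
    { obj := X
      map := fun S => descMap X e S
      map₂ := L
      map₂_id := fun S => (hp.map₂_bijective _ _).1 ?_
      map₂_comp := fun η θ => (hp.map₂_bijective _ _).1 ?_
      map_id := descMap_id X e
      map_comp := descMap_comp X e
      map₂_whisker_left := fun f _ _ η => (hp.map₂_bijective _ _).1 ?_
      map₂_whisker_right := fun η g => (hp.map₂_bijective _ _).1 ?_ }, ?_, fun _ => rfl,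
    fun i j h => heq_of_eq (descMap_edge X e h)⟩
  · simp [hL, S2id]
  · simp [hL, S2comp]
  · simp [hL, hwl, p.map₂_whisker_left, p.mapComp_eq_eqToIso, PrelaxFunctor.map₂_eqToHom]
  · simp [hL, hwr, p.map₂_whisker_right, p.mapComp_eq_eqToIso, PrelaxFunctor.map₂_eqToHom]
  · obtain rfl : @(fun x y S T η => p.map₂ (L η)) = @S2 := by
      funext x y S T η
      exact hL η
    rfl

/-- Two lifts along a trivial fibration of a 2-functor out of `𝒪(E)` are equal if they agree on
objects and on edges. -/
theorem hom_ext (hp : IsTrivialTwoFibration p) {τ τ' : StrictPseudofunctor (Oriental E) P}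
    (h : τ.comp p = τ'.comp p)
    (hobj : ∀ i, τ.obj i = τ'.obj i)
    (hedge : ∀ (i j : Oriental E) (h : i.pt < j.pt),
      HEq (τ.map (edge i j h.le)) (τ'.map (edge i j h.le))) : τ = τ' := by
  apply _root_.strictPseudofunctor_ext
  have h2 : ∀ {x y : Oriental E} {S T : x ⟶ y} (η : S ⟶ T),
      HEq (p.map₂ (τ.map₂ η)) (p.map₂ (τ'.map₂ η)) := fun η =>
    StrictPseudofunctor.map₂_heq h η
  have hid := τ.map_id
  have hid' := τ'.map_id
  have hcomp := @τ.map_comp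
  have hcomp' := @τ'.map_comp
  clear h
  obtain ⟨⟨⟨⟨⟨⟨Fo, Fm⟩, F2⟩, _, _⟩, _, _, _, _, _, _, _⟩, _, _⟩, _, _⟩ := τ
  obtain ⟨⟨⟨⟨⟨⟨Go, Gm⟩, G2⟩, _, _⟩, _, _, _, _, _, _, _⟩, _, _⟩, _, _⟩ := τ'
  dsimp at hobj hedge h2 hid hid' hcomp hcomp' ⊢
  obtain rfl : Fo = Go := funext hobj
  obtain rfl : @Fm = @Gm := by
    funext x y S
    induction S using hom_induction with
    | id x => rw [hid, hid']
    | cons x y z h S ih => rw [hcomp, hcomp', ih, eq_of_heq (hedge x y h)]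
  obtain rfl : @F2 = @G2 := by
    funext x y S T η
    exact (hp.map₂_bijective _ _).1 (eq_of_heq (h2 η))
  rfl

end IsTrivialTwoFibration

/-! ### The nerve of a trivial fibration -/

namespace IsTrivialTwoFibration

open Oriental

section

variable {P : Type u₁} {Q : Type u₂} [Bicategory.{w₁, v₁} P] [Bicategory.{w₂, v₂} Q]
  {p : StrictPseudofunctor P Q}

theorem map_heq_map {x x' y y' : P} (hx : x = x') (hy : y = y') {f : x ⟶ y} {f' : x' ⟶ y'}
    (h : HEq f f') : HEq (p.map f) (p.map f') := by
  subst hx hy h; rfl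

theorem exists_map_heq (hp : IsTrivialTwoFibration p) {x y : P} {x' y' : Q} (hx : p.obj x = x')
    (hy : p.obj y = y') (f : x' ⟶ y') : ∃ g : x ⟶ y, HEq (p.map g) f := by
  subst hx hy
  obtain ⟨g, hg⟩ := hp.map_surjective x y f
  exact ⟨g, heq_of_eq hg⟩

end

theorem _root_.Oriental.map_edge {E E' : Type w} [LinearOrder E] [LinearOrder E'] (φ : E →o E')
    (x y : Oriental E) (h : x.pt ≤ y.pt) :
    (Oriental.map φ).map (edge x y h) = edge ⟨φ x.pt⟩ ⟨φ y.pt⟩ (φ.monotone h) := by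
  refine Oriental.hom_ext ?_
  change Finset.image φ {x.pt, y.pt} = {φ x.pt, φ y.pt}
  rw [Finset.image_insert, Finset.image_singleton]

variable {P Q : Type u} [Bicategory.{u, u} P] [Bicategory.{u, u} Q] [Bicategory.Strict P]
  [Bicategory.Strict Q] {p : StrictPseudofunctor P Q}

section

variable {n : ℕ} {t : (∂Δ[n] : SSet.{u}) ⟶ streetNerve P}

/-- The 2-functor given by the value of `t` on a simplex of `∂Δ[n]`. -/
def ofBoundary (t : (∂Δ[n] : SSet.{u}) ⟶ streetNerve P) {m : ℕ} (φ : Fin (m + 1) →o Fin (n + 1))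
    (hφ : ¬ Function.Surjective φ) : StrictPseudofunctor (Oriental (Fin (m + 1))) P :=
  t.app (op ⦋m⦌) ⟨SSet.stdSimplex.objMk φ, hφ⟩

/-- The 2-functor corresponding to a morphism `Δ[n] ⟶ N₂(Q)`. -/
def toTwoFunctor {Q : Type u} [Bicategory.{u, u} Q] [Bicategory.Strict Q] {n : ℕ}
    (b : (Δ[n] : SSet.{u}) ⟶ streetNerve Q) : StrictPseudofunctor (Oriental (Fin (n + 1))) Q :=
  SSet.yonedaEquiv b

theorem ofBoundary_comp {m m' : ℕ} (φ : Fin (m + 1) →o Fin (n + 1))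
    (hφ : ¬ Function.Surjective φ) (ψ : Fin (m' + 1) →o Fin (m + 1))
    (h : ¬ Function.Surjective (φ.comp ψ)) :
    ofBoundary t (φ.comp ψ) h = (Oriental.map ψ).comp (ofBoundary t φ hφ) :=
  ConcreteCategory.congr_hom (t.naturality (SimplexCategory.mkHom ψ).op)
    ⟨SSet.stdSimplex.objMk φ, hφ⟩

theorem ofBoundary_comp_eq {b : (Δ[n] : SSet.{u}) ⟶ streetNerve Q}
    (w : t ≫ streetNerveMap p = ∂Δ[n].ι ≫ b) {m : ℕ} (φ : Fin (m + 1) →o Fin (n + 1))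
    (hφ : ¬ Function.Surjective φ) :
    (ofBoundary t φ hφ).comp p = (Oriental.map φ).comp (toTwoFunctor b) := by
  refine (ConcreteCategory.congr_hom (congr_app w (op ⦋m⦌))
    ⟨SSet.stdSimplex.objMk φ, hφ⟩).trans ?_
  exact ConcreteCategory.congr_hom (b.naturality (SimplexCategory.mkHom φ).op)
    (SSet.stdSimplex.objMk OrderHom.id)

theorem not_surjective_of_lt {m n : ℕ} (h : m < n) (φ : Fin (m + 1) → Fin (n + 1)) :
    ¬ Function.Surjective φ := fun hφ => by
  have := Fintype.card_le_of_surjective φ hφ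
  simp at this
  omega

/-- For `n = 0` the boundary is empty and surjectivity on objects supplies the vertex. For `n > 0`
every vertex lies in the boundary, so `t` dictates the choice. -/
theorem exists_obj_lift (hp : IsTrivialTwoFibration p) {b : (Δ[n] : SSet.{u}) ⟶ streetNerve Q}
    (w : t ≫ streetNerveMap p = ∂Δ[n].ι ≫ b) :
    ∃ X : Oriental (Fin (n + 1)) → P,
      (∀ i, p.obj (X i) = (toTwoFunctor b).obj i) ∧
      ∀ {m : ℕ} (φ : Fin (m + 1) →o Fin (n + 1)) (hφ : ¬ Function.Surjective φ) (k),
        (ofBoundary t φ hφ).obj ⟨k⟩ = X ⟨φ k⟩ := by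
  obtain _ | n := n
  · choose X hX using fun i =>
      hp.obj_surjective ((toTwoFunctor b).obj i)
    exact ⟨X, hX, fun φ hφ => (hφ fun j => ⟨0, Fin.ext (by omega)⟩).elim⟩
  · refine ⟨fun i => (ofBoundary t (m := 0) (OrderHom.const _ i.pt)
      (not_surjective_of_lt (by omega) _)).obj ⟨0⟩, fun i => ?_, fun {m} φ hφ k => ?_⟩
    · exact congrArg (fun F : StrictPseudofunctor _ _ => F.obj ⟨0⟩)
        (ofBoundary_comp_eq w (m := 0) (OrderHom.const _ i.pt) _)
    · exact (congrArg (fun F : StrictPseudofunctor _ _ => F.obj ⟨0⟩)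
        (ofBoundary_comp (t := t) φ hφ (m' := 0) (OrderHom.const _ k)
          (not_surjective_of_lt (by omega) _))).symm

/-- The order-preserving map `{0 < 1} → E` with values `i ≤ j`. -/
def pairHom {n : ℕ} (i j : Fin n) (h : i ≤ j) : Fin (1 + 1) →o Fin n :=
  ⟨![i, j], by
    intro a b hab
    fin_cases a <;> fin_cases b <;> simp_all⟩

/-- For `n < 2` a simplex of the boundary contains no nondegenerate edge, and fullness on 1-cells
supplies the lift. For `n ≥ 2` every edge lies in the boundary, so `t` dictates the choice. -/
theorem exists_edge_lift (hp : IsTrivialTwoFibration p) {b : (Δ[n] : SSet.{u}) ⟶ streetNerve Q}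
    (w : t ≫ streetNerveMap p = ∂Δ[n].ι ≫ b) (X : Oriental (Fin (n + 1)) → P)
    (hX : ∀ i, p.obj (X i) = (toTwoFunctor b).obj i)
    (hX' : ∀ {m : ℕ} (φ : Fin (m + 1) →o Fin (n + 1)) (hφ : ¬ Function.Surjective φ) (k),
        (ofBoundary t φ hφ).obj ⟨k⟩ = X ⟨φ k⟩) :
    ∃ e : ∀ i j : Oriental (Fin (n + 1)), i.pt < j.pt → (X i ⟶ X j),
      (∀ i j h, HEq (p.map (e i j h))
        ((toTwoFunctor b).map (edge i j h.le))) ∧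
      ∀ {m : ℕ} (φ : Fin (m + 1) →o Fin (n + 1)) (hφ : ¬ Function.Surjective φ) (i j : Fin (m + 1))
        (hij : i ≤ j) (h : φ i < φ j),
        HEq ((ofBoundary t φ hφ).map (edge ⟨i⟩ ⟨j⟩ hij)) (e ⟨φ i⟩ ⟨φ j⟩ h) := by
  by_cases hn : n < 2
  · choose e he using fun (i j : Oriental (Fin (n + 1))) (h : i.pt < j.pt) =>
      hp.exists_map_heq (hX i) (hX j)
        ((toTwoFunctor b).map (edge i j h.le))
    refine ⟨e, he, fun φ hφ i j hij h => (hφ fun k => ?_).elim⟩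
    by_cases hk : k = φ i
    · exact ⟨i, hk.symm⟩
    · exact ⟨j, by omega⟩
  · have hs : ∀ φ : Fin (1 + 1) → Fin (n + 1), ¬ Function.Surjective φ :=
      not_surjective_of_lt (by omega)
    choose e he using fun (i j : Oriental (Fin (n + 1))) (h : i.pt < j.pt) =>
      show ∃ g : X i ⟶ X j, HEq g ((ofBoundary t (m := 1) (pairHom i.pt j.pt h.le) (hs _)).map
          (edge ⟨0⟩ ⟨1⟩ (Fin.zero_le 1))) from
        ⟨cast (by rw [hX', hX']; rfl) ((ofBoundary t (m := 1) (pairHom i.pt j.pt h.le) (hs _)).map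
          (edge ⟨0⟩ ⟨1⟩ (Fin.zero_le 1))), cast_heq _ _⟩
    refine ⟨e, fun i j h => ?_, fun {m} φ hφ i j hij h => ?_⟩
    · refine (map_heq_map (p := p) (f := e i j h)
        (f' := (ofBoundary t (m := 1) (pairHom i.pt j.pt h.le) (hs _)).map
          (edge ⟨0⟩ ⟨1⟩ (Fin.zero_le 1)))
        (hX' (m := 1) _ (hs _) 0).symm (hX' (m := 1) _ (hs _) 1).symm (he i j h)).trans ?_
      refine (StrictPseudofunctor.map_heq (ofBoundary_comp_eq w (m := 1) (pairHom i.pt j.pt h.le)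
        (hs _)) (edge ⟨0⟩ ⟨1⟩ (Fin.zero_le 1))).trans (heq_of_eq ?_)
      exact congrArg ((toTwoFunctor b).map)
        (Oriental.map_edge (pairHom i.pt j.pt h.le) ⟨0⟩ ⟨1⟩ (Fin.zero_le 1))
    · refine HEq.trans ?_ (he _ _ _).symm
      have hc : φ.comp (pairHom i j hij) = pairHom (φ i) (φ j) h.le := by
        ext a
        fin_cases a <;> rfl
      have key : ofBoundary t (m := 1) (pairHom (φ i) (φ j) h.le) (hs _) =
          (Oriental.map (pairHom i j hij)).comp (ofBoundary t φ hφ) := by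
        rw [← ofBoundary_comp (m' := 1) φ hφ (pairHom i j hij) (hs _)]
        congr 1
        exact hc.symm
      refine ((StrictPseudofunctor.map_heq key (edge ⟨0⟩ ⟨1⟩ (Fin.zero_le 1))).trans
        (heq_of_eq ?_)).symm
      exact congrArg (ofBoundary t φ hφ).map
        (Oriental.map_edge (pairHom i j hij) ⟨0⟩ ⟨1⟩ (Fin.zero_le 1))

end

/-- The nerve of a trivial fibration of 2-categories is a trivial Kan fibration. -/
theorem rlp_streetNerveMap (hp : IsTrivialTwoFibration p) :
    (MorphismProperty.monomorphisms SSet.{u}).rlp (streetNerveMap p) := by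
  rw [SSet.rlp_monomorphisms]
  rintro _ _ _ ⟨n⟩
  constructor
  intro t b sq
  obtain ⟨X, hX, hX'⟩ := hp.exists_obj_lift sq.w
  obtain ⟨e, he, he'⟩ := hp.exists_edge_lift sq.w X hX hX'
  obtain ⟨τ, hτ, hτX, hτe⟩ := hp.exists_lift _ X hX e he
  -- Strict monotonicity keeps edges nondegenerate, where `e` is defined. This loses nothing, since
  -- maps out of the boundary are determined by the injective faces of codimension one.
  have hτ' : ∀ {m : ℕ} (φ : Fin (m + 1) →o Fin (n + 1)) (hφ : ¬ Function.Surjective φ),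
      StrictMono φ → (Oriental.map φ).comp τ = ofBoundary t φ hφ := by
    intro m φ hφ hm
    refine hp.hom_ext ?_ (fun i => ?_) fun i j h => ?_
    · rw [ofBoundary_comp_eq sq.w, ← hτ, strictPseudofunctor_comp_assoc]
    · exact (hτX _).trans (hX' φ hφ i.pt).symm
    · refine HEq.trans ?_ (he' φ hφ i.pt j.pt h.le (hm h)).symm
      exact (heq_of_eq (congrArg τ.map (Oriental.map_edge φ i j h.le))).trans (hτe _ _ (hm h))
  refine ⟨⟨SSet.yonedaEquiv.symm τ, ?_, ?_⟩⟩
  · obtain _ | n := n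
    · exact SSet.boundary.hom_ext₀
    · refine SSet.boundary.hom_ext fun k => SSet.yonedaEquiv.injective ?_
      have hk : ¬ Function.Surjective k.succAboveOrderEmb.toOrderHom := fun h => by
        obtain ⟨a, ha⟩ := h k
        exact Fin.succAbove_ne k a ha
      exact hτ' k.succAboveOrderEmb.toOrderHom hk k.succAboveOrderEmb.strictMono
  · apply SSet.yonedaEquiv.injective
    refine (SSet.yonedaEquiv_comp _ _).trans (Eq.trans ?_ hτ)
    exact congrArg (StrictPseudofunctor.comp · p) 
      ((SSet.yonedaEquiv (X := streetNerve P) (n := ⦋n⦌)).apply_symm_apply τ)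

end IsTrivialTwoFibration

/-! ### The iso-comma 2-category -/

theorem whiskerLeft_congr {B : Type u₁} [Bicategory.{w₁, v₁} B] {a b c : B} {f g : a ⟶ b}
    (h : f = g) {k l : b ⟶ c} (η : k ⟶ l) :
    f ◁ η = eqToHom (by rw [h]) ≫ g ◁ η ≫ eqToHom (by rw [h]) := by
  subst h; simp

section

variable {A B : Type u} [Bicategory.{u, u} A] [Bicategory.Strict A]
    [Bicategory.{u, u} B] [Bicategory.Strict B] (F : StrictPseudofunctor A B)

/-- The objects of the iso-comma 2-category of `F`: weakly invertible 1-cells `F x ⟶ y`. -/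
structure IsoComma : Type u where
  src : A
  tgt : B
  hom : F.obj src ⟶ tgt
  weaklyInvertible : IsWeaklyInvertible hom

namespace IsoComma

variable {F}

/-- The 1-cells of the iso-comma 2-category of `F`: squares that commute up to an invertible
2-cell. -/
structure Hom (X Y : IsoComma F) : Type u where
  fst : X.src ⟶ Y.src
  snd : X.tgt ⟶ Y.tgt
  iso : X.hom ≫ snd ≅ F.map fst ≫ Y.hom

theorem Hom.ext' {X Y : IsoComma F} {s t : Hom X Y} (h₁ : s.fst = t.fst) (h₂ : s.snd = t.snd)
    (h : s.iso.hom = eqToHom (by rw [h₂]) ≫ t.iso.hom ≫ eqToHom (by rw [h₁])) : s = t := by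
  obtain ⟨f, g, a⟩ := s
  obtain ⟨f', g', a'⟩ := t
  dsimp at h₁ h₂
  subst h₁ h₂
  congr 1
  ext
  simpa using h

instance : CategoryStruct.{u} (IsoComma F) where
  Hom := Hom
  id X := ⟨𝟙 _, 𝟙 _, ρ_ X.hom ≪≫ (λ_ X.hom).symm ≪≫ whiskerRightIso (F.mapId X.src).symm X.hom⟩
  comp {X _ Z} s t := ⟨s.fst ≫ t.fst, s.snd ≫ t.snd,
    (α_ X.hom s.snd t.snd).symm ≪≫ whiskerRightIso s.iso t.snd ≪≫ α_ _ _ _ ≪≫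
      whiskerLeftIso (F.map s.fst) t.iso ≪≫ (α_ _ _ _).symm ≪≫
      whiskerRightIso (F.mapComp s.fst t.fst).symm Z.hom⟩

@[simp] theorem id_fst (X : IsoComma F) : Hom.fst (𝟙 X) = 𝟙 X.src := rfl
@[simp] theorem id_snd (X : IsoComma F) : Hom.snd (𝟙 X) = 𝟙 X.tgt := rfl
@[simp] theorem comp_fst {X Y Z : IsoComma F} (s : X ⟶ Y) (t : Y ⟶ Z) :
    Hom.fst (s ≫ t) = s.fst ≫ t.fst := rfl
@[simp] theorem comp_snd {X Y Z : IsoComma F} (s : X ⟶ Y) (t : Y ⟶ Z) :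
    Hom.snd (s ≫ t) = s.snd ≫ t.snd := rfl

/-- By strictness all coherence cells are `eqToHom`s. In this form, here and in `comp_iso_hom`, they
cancel in the proofs of the strict unit and associativity laws. -/
theorem id_iso_hom (X : IsoComma F) : (Hom.iso (𝟙 X)).hom =
    eqToHom (by rw [id_snd, id_fst, F.map_id, Strict.id_comp, Strict.comp_id]) := by
  change (ρ_ X.hom).hom ≫ (λ_ X.hom).inv ≫ (F.mapId X.src).inv ▷ X.hom = _
  simp [Strict.leftUnitor_eqToIso, Strict.rightUnitor_eqToIso, F.mapId_eq_eqToIso]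

theorem comp_iso_hom {X Y Z : IsoComma F} (s : X ⟶ Y) (t : Y ⟶ Z) : (Hom.iso (s ≫ t)).hom =
    eqToHom (by rw [comp_snd, Strict.assoc]) ≫ s.iso.hom ▷ t.snd ≫
      eqToHom (by rw [Strict.assoc]) ≫ F.map s.fst ◁ t.iso.hom ≫
      eqToHom (by rw [comp_fst, F.map_comp, Strict.assoc]) := by
  change (α_ _ _ _).inv ≫ s.iso.hom ▷ t.snd ≫ (α_ _ _ _).hom ≫ F.map s.fst ◁ t.iso.hom ≫
    (α_ _ _ _).inv ≫ (F.mapComp s.fst t.fst).inv ▷ Z.hom = _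
  simp [Strict.associator_eqToIso, F.mapComp_eq_eqToIso]

theorem id_comp' {X Y : IsoComma F} (s : X ⟶ Y) : 𝟙 X ≫ s = s := by
  refine Hom.ext' (Strict.id_comp _) (Strict.id_comp _) ?_
  simp [comp_iso_hom, id_iso_hom, whiskerLeft_congr (F.map_id X.src), Strict.leftUnitor_eqToIso]

theorem comp_id' {X Y : IsoComma F} (s : X ⟶ Y) : s ≫ 𝟙 Y = s := by
  refine Hom.ext' (Strict.comp_id _) (Strict.comp_id _) ?_
  simp [comp_iso_hom, id_iso_hom, Strict.rightUnitor_eqToIso]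

theorem assoc' {X Y Z T : IsoComma F} (s : X ⟶ Y) (t : Y ⟶ Z) (r : Z ⟶ T) :
    (s ≫ t) ≫ r = s ≫ t ≫ r := by
  refine Hom.ext' (Strict.assoc _ _ _) (Strict.assoc _ _ _) ?_
  simp [comp_iso_hom, whiskerLeft_congr (F.map_comp s.fst t.fst), Strict.associator_eqToIso]

/-- The 2-cells of the iso-comma 2-category are given by their component in `A`, which determines
the component in `B`. -/
instance (X Y : IsoComma F) : Category.{u} (X ⟶ Y) where
  Hom s t := s.fst ⟶ t.fst
  id s := 𝟙 s.fst
  comp η θ := (η ≫ θ : _ ⟶ _)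

theorem eqToHom_def {X Y : IsoComma F} {s t : X ⟶ Y} (h : s = t) :
    (eqToHom h : s ⟶ t) = (eqToHom (congrArg Hom.fst h) : s.fst ⟶ t.fst) := by
  subst h; rfl

/-- An invertible 2-cell. -/
def isoMk {X Y : IsoComma F} {s t : X ⟶ Y} (e : s.fst ≅ t.fst) : s ≅ t :=
  ⟨e.hom, e.inv, e.hom_inv_id, e.inv_hom_id⟩

instance : Bicategory.{u, u} (IsoComma F) where
  homCategory _ _ := inferInstance
  whiskerLeft s _ _ η := (s.fst ◁ η : _ ⟶ _)
  whiskerRight η t := (η ▷ t.fst : _ ⟶ _)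
  associator s t r := isoMk (α_ s.fst t.fst r.fst)
  leftUnitor s := isoMk (λ_ s.fst)
  rightUnitor s := isoMk (ρ_ s.fst)
  whiskerLeft_id _ _ := Bicategory.whiskerLeft_id _ _
  whiskerLeft_comp _ _ _ _ _ _ := Bicategory.whiskerLeft_comp _ _ _
  id_whiskerLeft _ := Bicategory.id_whiskerLeft _
  comp_whiskerLeft _ _ _ _ _ := Bicategory.comp_whiskerLeft _ _ _
  id_whiskerRight _ _ := Bicategory.id_whiskerRight _ _
  comp_whiskerRight _ _ _ := Bicategory.comp_whiskerRight _ _ _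
  whiskerRight_id _ := Bicategory.whiskerRight_id _
  whiskerRight_comp _ _ _ := Bicategory.whiskerRight_comp _ _ _
  whisker_assoc _ _ _ _ _ := Bicategory.whisker_assoc _ _ _
  whisker_exchange _ _ := Bicategory.whisker_exchange _ _
  pentagon _ _ _ _ := Bicategory.pentagon _ _ _ _
  triangle _ _ := Bicategory.triangle _ _

instance : Bicategory.Strict (IsoComma F) where
  id_comp := id_comp'
  comp_id := comp_id'
  assoc := assoc'
  leftUnitor_eqToIso s := Iso.ext <| by
    refine Eq.trans ?_ (eqToHom_def (id_comp' s)).symm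
    exact congrArg Iso.hom (Strict.leftUnitor_eqToIso s.fst)
  rightUnitor_eqToIso s := Iso.ext <| by
    refine Eq.trans ?_ (eqToHom_def (comp_id' s)).symm
    exact congrArg Iso.hom (Strict.rightUnitor_eqToIso s.fst)
  associator_eqToIso s t r := Iso.ext <| by
    refine Eq.trans ?_ (eqToHom_def (assoc' s t r)).symm
    exact congrArg Iso.hom (Strict.associator_eqToIso s.fst t.fst r.fst)

end IsoComma

end

theorem prelaxFunctor_mk_eq {B : Type u₁} {C : Type u₂} [Bicategory.{w₁, v₁} B]
    [Bicategory.{w₂, v₂} C] (F : PrelaxFunctor B C)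
    (m : ∀ {x y : B} {f g : x ⟶ y}, (f ⟶ g) → (F.map f ⟶ F.map g))
    (h : ∀ {x y : B} {f g : x ⟶ y} (η : f ⟶ g), m η = F.map₂ η) (h₁ h₂) :
    ({ toPrefunctor := F.toPrefunctor, map₂ := m, map₂_id := h₁, map₂_comp := h₂ } :
      PrelaxFunctor B C) = F := by
  obtain rfl : @m = @F.map₂ := by
    funext x y f g η
    exact h η
  rfl

theorem CategoryTheory.Functor.existsUnique_map_eq {C : Type u₁} {D : Type u₂} [Category.{v₁} C]
    [Category.{v₂} D] (G : C ⥤ D) [G.Full] [G.Faithful] {x y : C} (f : G.obj x ⟶ G.obj y) :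
    ∃! g, G.map g = f :=
  ⟨G.preimage f, G.map_preimage f, fun _ hg => G.map_injective (hg.trans (G.map_preimage f).symm)⟩

/-! ### Composition with a weakly invertible 1-cell -/

namespace IsWeaklyInvertible

variable {B : Type u} [Bicategory.{u, u} B] [Bicategory.Strict B] {x y : B} {f : x ⟶ y}

/-- Composition with a weak inverse is a quasi-inverse: the two invertible 2-cells, whiskered, give
the unit and the counit. -/
theorem isEquivalence_precomp (hf : IsWeaklyInvertible f) (z : B) :
    (precomp z f).IsEquivalence := by
  obtain ⟨g, ⟨a⟩, ⟨b⟩⟩ := hf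
  exact (CategoryTheory.Equivalence.mk (precomp z f) (precomp z g)
    ((leftUnitorNatIso y z).symm ≪≫ (precomposing y y z).mapIso b.symm ≪≫
      associatorNatIsoRight g f z)
    ((associatorNatIsoRight f g z).symm ≪≫ (precomposing x x z).mapIso a ≪≫
      leftUnitorNatIso x z)).isEquivalence_functor

theorem isEquivalence_postcomp (hf : IsWeaklyInvertible f) (z : B) :
    (postcomp z f).IsEquivalence := by
  obtain ⟨g, ⟨a⟩, ⟨b⟩⟩ := hf
  exact (CategoryTheory.Equivalence.mk (postcomp z f) (postcomp z g)
    ((rightUnitorNatIso z x).symm ≪≫ (postcomposing z x x).mapIso a.symm ≪≫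
      (associatorNatIsoLeft z f g).symm)
    (associatorNatIsoLeft z g f ≪≫ (postcomposing z y y).mapIso b ≪≫
      rightUnitorNatIso z y)).isEquivalence_functor

theorem id (x : B) : IsWeaklyInvertible (𝟙 x) :=
  ⟨𝟙 x, ⟨λ_ _⟩, ⟨λ_ _⟩⟩

end IsWeaklyInvertible

/-! ### The two projections and the diagonal -/

namespace IsoComma

variable {A B : Type u} [Bicategory.{u, u} A] [Bicategory.Strict A]
    [Bicategory.{u, u} B] [Bicategory.Strict B] {F : StrictPseudofunctor A B}

theorem eqToHom_comp_comp_eqToHom {X Y : IsoComma F} {s s' t t' : X ⟶ Y} (h : s = s') (h' : t' = t)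
    (η : s' ⟶ t') : (eqToHom h ≫ η ≫ eqToHom h' : s ⟶ t) =
      (eqToHom (congrArg Hom.fst h) ≫ (show s'.fst ⟶ t'.fst from η) ≫
        eqToHom (congrArg Hom.fst h') : s.fst ⟶ t.fst) := by
  subst h h'
  simp only [eqToHom_refl, Category.id_comp, Category.comp_id]

/-- The projection of the iso-comma 2-category to `A`. -/
def fstFunctor (F : StrictPseudofunctor A B) : StrictPseudofunctor (IsoComma F) A :=
  StrictPseudofunctor.mk''
    { obj := IsoComma.src
      map := Hom.fst
      map₂ := fun η => η
      map₂_id := fun _ => rfl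
      map₂_comp := fun _ _ => rfl
      map_id := fun _ => rfl
      map_comp := fun _ _ => rfl
      map₂_whisker_left := fun f _ _ η => by
        simp only [eqToHom_refl, Category.id_comp, Category.comp_id]; rfl
      map₂_whisker_right := fun η g => by
        simp only [eqToHom_refl, Category.id_comp, Category.comp_id]; rfl }

/-- A 2-cell of `A` and a 2-cell of `B` are compatible if they form a 2-cell between squares. -/
def Compatible {X Y : IsoComma F} (s t : X ⟶ Y) (η : s.fst ⟶ t.fst) (θ : s.snd ⟶ t.snd) : Prop :=
  X.hom ◁ θ ≫ t.iso.hom = s.iso.hom ≫ F.map₂ η ▷ Y.hom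

namespace Compatible

variable {X Y Z : IsoComma F}

theorem id (s : X ⟶ Y) : Compatible s s (𝟙 _) (𝟙 _) := by
  simp [Compatible]

theorem comp {s t r : X ⟶ Y} {η : s.fst ⟶ t.fst} {θ : s.snd ⟶ t.snd} {η' : t.fst ⟶ r.fst}
    {θ' : t.snd ⟶ r.snd} (h : Compatible s t η θ) (h' : Compatible t r η' θ') :
    Compatible s r (η ≫ η') (θ ≫ θ') := by
  simp only [Compatible] at h h' ⊢
  rw [whiskerLeft_comp, Category.assoc, h', reassoc_of% h, PrelaxFunctor.map₂_comp,
    comp_whiskerRight]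

/-- The interchange law slides `θ` past the 2-cell of `r`; what remains is `h` whiskered by `F.map
r.fst`. -/
theorem whiskerLeft (r : X ⟶ Y) {s t : Y ⟶ Z} {η : s.fst ⟶ t.fst} {θ : s.snd ⟶ t.snd}
    (h : Compatible s t η θ) : Compatible (r ≫ s) (r ≫ t) (r.fst ◁ η) (r.snd ◁ θ) := by
  have h1 := congrArg (F.map r.fst ◁ ·) h
  have h2 := whisker_exchange r.iso.hom θ
  simp only [Bicategory.whiskerLeft_comp, comp_whiskerLeft, Strict.associator_eqToIso,
    eqToIso.hom, eqToIso.inv, Category.assoc] at h1 h2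
  simp only [Compatible, comp_iso_hom, comp_snd, comp_fst]
  simp [F.map₂_whisker_left, F.mapComp_eq_eqToIso, Strict.associator_eqToIso]
  rw [eqToHom_comp_iff] at h2
  rw [reassoc_of% h2]
  simp only [eqToHom_trans_assoc, eqToHom_refl, Category.id_comp]
  rw [reassoc_of% h1]

theorem whiskerRight {s t : X ⟶ Y} {η : s.fst ⟶ t.fst} {θ : s.snd ⟶ t.snd}
    (h : Compatible s t η θ) (r : Y ⟶ Z) :
    Compatible (s ≫ r) (t ≫ r) (η ▷ r.fst) (θ ▷ r.snd) := by
  have h1 := congrArg (· ▷ r.snd) h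
  have h2 := whisker_exchange (F.map₂ η) r.iso.hom
  simp only [comp_whiskerRight, whisker_assoc, Strict.associator_eqToIso, whiskerRight_comp,
    eqToIso.hom, eqToIso.inv, Category.assoc] at h1 h2
  simp only [Compatible, comp_iso_hom, comp_snd, comp_fst]
  simp [F.map₂_whisker_right, F.mapComp_eq_eqToIso]
  rw [eqToHom_comp_iff] at h1
  symm at h2
  rw [eqToHom_comp_iff] at h2
  rw [reassoc_of% h1, reassoc_of% h2]
  simp only [eqToHom_trans]

/-- As `t.iso` is invertible, compatibility prescribes `X.hom ◁ θ`, and whiskering with the weakly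
invertible `X.hom` is fully faithful. -/
theorem existsUnique_snd (s t : X ⟶ Y) (η : s.fst ⟶ t.fst) : ∃! θ, Compatible s t η θ := by
  have := X.weaklyInvertible.isEquivalence_precomp Y.tgt
  exact (existsUnique_congr fun θ => (Iso.eq_comp_inv t.iso).symm).2
    ((precomp Y.tgt X.hom).existsUnique_map_eq
      ((s.iso.hom ≫ F.map₂ η ▷ Y.hom) ≫ t.iso.inv))

/-- Compatibility prescribes `F.map₂ η ▷ Y.hom`, the value at `η` of a composite of two
equivalences: `F` on hom-categories and composition with `Y.hom`. -/
theorem existsUnique_fst (hF : IsBiequivalence F) (s t : X ⟶ Y) (θ : s.snd ⟶ t.snd) :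
    ∃! η, Compatible s t η θ := by
  have := Y.weaklyInvertible.isEquivalence_postcomp (F.obj X.src)
  have := hF.1 X.src Y.src
  let G := F.mapFunctor X.src Y.src ⋙ postcomp (F.obj X.src) Y.hom
  exact (existsUnique_congr fun η => eq_comm.trans (Iso.eq_inv_comp s.iso).symm).2
    (G.existsUnique_map_eq (s.iso.inv ≫ X.hom ◁ θ ≫ t.iso.hom))

end Compatible

/-- The component in `B` of a 2-cell. -/
noncomputable def map₂Snd {X Y : IsoComma F} {s t : X ⟶ Y} (η : s ⟶ t) : s.snd ⟶ t.snd :=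
  (Compatible.existsUnique_snd s t η).choose

theorem compatible_map₂Snd {X Y : IsoComma F} {s t : X ⟶ Y} (η : s ⟶ t) :
    Compatible s t η (map₂Snd η) :=
  (Compatible.existsUnique_snd s t η).choose_spec.1

/-- This reduces each 2-cell law of `sndFunctor` to the stability of compatible pairs under the
operation concerned. -/
theorem eq_map₂Snd {X Y : IsoComma F} {s t : X ⟶ Y} (η : s ⟶ t) {θ : s.snd ⟶ t.snd}
    (h : Compatible s t η θ) : map₂Snd η = θ :=
  (Compatible.existsUnique_snd s t η).unique (compatible_map₂Snd η) h

/-- The projection of the iso-comma 2-category to `B`. -/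
noncomputable def sndFunctor (F : StrictPseudofunctor A B) : StrictPseudofunctor (IsoComma F) B :=
  StrictPseudofunctor.mk''
    { obj := IsoComma.tgt
      map := Hom.snd
      map₂ := map₂Snd
      map₂_id := fun s => eq_map₂Snd _ (Compatible.id s)
      map₂_comp := fun η θ =>
        eq_map₂Snd _ ((compatible_map₂Snd η).comp (compatible_map₂Snd θ))
      map_id := fun _ => rfl
      map_comp := fun _ _ => rfl
      map₂_whisker_left := fun f _ _ η => by
        simp only [eqToHom_refl, Category.id_comp, Category.comp_id]
        exact eq_map₂Snd _ ((compatible_map₂Snd η).whiskerLeft f)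
      map₂_whisker_right := fun η g => by
        simp only [eqToHom_refl, Category.id_comp, Category.comp_id]
        exact eq_map₂Snd _ ((compatible_map₂Snd η).whiskerRight g) }

/-- A 1-cell `f` of `A` is completed to a square because precomposition with `X.hom` is essentially
surjective; on 2-cells the projection is the identity by construction. -/
theorem isTrivialTwoFibration_fstFunctor (F : StrictPseudofunctor A B) :
    IsTrivialTwoFibration (fstFunctor F) where
  obj_surjective x := ⟨⟨x, F.obj x, 𝟙 _, .id _⟩, rfl⟩
  map_surjective X Y f := by
    have := X.weaklyInvertible.isEquivalence_precomp Y.tgt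
    exact ⟨⟨f, _, (precomp Y.tgt X.hom).objObjPreimageIso (F.map f ≫ Y.hom)⟩, rfl⟩
  map₂_bijective _ _ := Function.bijective_id

/-- Surjectivity on objects is the second clause of `IsBiequivalence`. The first makes `f ↦ F f ≫
Y.hom` an equivalence of hom-categories, which gives the rest. -/
theorem isTrivialTwoFibration_sndFunctor (hF : IsBiequivalence F) :
    IsTrivialTwoFibration (sndFunctor F) where
  obj_surjective y := by
    obtain ⟨x, f, hf⟩ := hF.2 y
    exact ⟨⟨x, y, f, hf⟩, rfl⟩
  map_surjective X Y h := by
    have := Y.weaklyInvertible.isEquivalence_postcomp (F.obj X.src)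
    have := hF.1 X.src Y.src
    let G := F.mapFunctor X.src Y.src ⋙ postcomp (F.obj X.src) Y.hom
    exact ⟨⟨_, h, (G.objObjPreimageIso (X.hom ≫ h)).symm⟩, rfl⟩
  map₂_bijective s t := by
    constructor
    · intro η η' h
      refine (Compatible.existsUnique_fst hF s t (map₂Snd η)).unique (compatible_map₂Snd η) ?_
      have := compatible_map₂Snd η'
      rwa [← show map₂Snd η = map₂Snd η' from h] at this
    · intro θ
      obtain ⟨η, hη, -⟩ := Compatible.existsUnique_fst hF s t θ
      exact ⟨η, eq_map₂Snd _ hη⟩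

/-- The section of the projection to `A` given by the identities `F x ⟶ F x`. -/
def diagonal (F : StrictPseudofunctor A B) : StrictPseudofunctor A (IsoComma F) :=
  StrictPseudofunctor.mk''
    { obj := fun x => ⟨x, F.obj x, 𝟙 _, .id _⟩
      map := fun f => ⟨f, F.map f, λ_ _ ≪≫ (ρ_ _).symm⟩
      map₂ := fun η => η
      map₂_id := fun _ => rfl
      map₂_comp := fun _ _ => rfl
      map_id := fun x => by
        refine Hom.ext' rfl (F.map_id x) ?_
        simp [id_iso_hom, Strict.leftUnitor_eqToIso, Strict.rightUnitor_eqToIso]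
      map_comp := fun f g => by
        refine Hom.ext' rfl (F.map_comp f g) ?_
        simp [comp_iso_hom, Strict.leftUnitor_eqToIso, Strict.rightUnitor_eqToIso]
      map₂_whisker_left := fun f _ _ η => by
        refine Eq.trans ?_ (eqToHom_comp_comp_eqToHom _ _ _).symm
        exact ((Category.id_comp _).trans (Category.comp_id _)).symm
      map₂_whisker_right := fun η g => by
        refine Eq.trans ?_ (eqToHom_comp_comp_eqToHom _ _ _).symm
        exact ((Category.id_comp _).trans (Category.comp_id _)).symm }

theorem diagonal_comp_fstFunctor (F : StrictPseudofunctor A B) :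
    (diagonal F).comp (fstFunctor F) = StrictPseudofunctor.id A :=
  strictPseudofunctor_ext rfl

/-- Only the action on 2-cells, which was obtained by choice, needs an argument: `F.map₂ η` is
compatible with `η` by naturality of the unitors, so uniqueness identifies it with the chosen
component. -/
theorem diagonal_comp_sndFunctor (F : StrictPseudofunctor A B) :
    (diagonal F).comp (sndFunctor F) = F := by
  have h : ∀ {x y : A} {f g : x ⟶ y} (η : f ⟶ g),
      map₂Snd ((diagonal F).map₂ η) = F.map₂ η := fun η => eq_map₂Snd _ (by
    change 𝟙 _ ◁ F.map₂ η ≫ (λ_ _).hom ≫ (ρ_ _).inv =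
      ((λ_ _).hom ≫ (ρ_ _).inv) ≫ F.map₂ η ▷ 𝟙 _
    simp)
  apply strictPseudofunctor_ext
  exact prelaxFunctor_mk_eq F.toPrelaxFunctor _ h _ _

end IsoComma

theorem streetNerveMap_comp {A B C : Type u} [Bicategory.{u, u} A] [Bicategory.Strict A]
    [Bicategory.{u, u} B] [Bicategory.Strict B] [Bicategory.{u, u} C] [Bicategory.Strict C]
    (F : StrictPseudofunctor A B) (G : StrictPseudofunctor B C) :
    streetNerveMap F ≫ streetNerveMap G = streetNerveMap (F.comp G) := by
  ext m H
  exact strictPseudofunctor_comp_assoc H F G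

theorem streetNerveMap_id (A : Type u) [Bicategory.{u, u} A] [Bicategory.Strict A] :
    streetNerveMap (StrictPseudofunctor.id A) = 𝟙 (streetNerve A) := by
  ext m H
  exact strictPseudofunctor_ext rfl

theorem mainTheorem11 {A B : Type u} [Bicategory.{u, u} A] [Bicategory.Strict A]
    [Bicategory.{u, u} B] [Bicategory.Strict B] (F : StrictPseudofunctor A B)
    (hF : IsBiequivalence F) : IsThomasonWeakEquivalence F := by
  refine ⟨streetNerve (IsoComma F), streetNerveMap (IsoComma.diagonal F),
    streetNerveMap (IsoComma.sndFunctor F), ?_,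
    (IsoComma.isTrivialTwoFibration_sndFunctor hF).rlp_streetNerveMap, ?_⟩
  · refine SSet.anodyneExtensions_of_section _ (streetNerveMap (IsoComma.fstFunctor F)) ?_
      (IsoComma.isTrivialTwoFibration_fstFunctor F).rlp_streetNerveMap
    rw [streetNerveMap_comp, IsoComma.diagonal_comp_fstFunctor, streetNerveMap_id]
  · rw [streetNerveMap_comp, IsoComma.diagonal_comp_sndFunctor]
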